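/- Write $\phi_f(t)=\int_{\mathbb R} e^{itx}f(x)\,dx$. Let $\psi_\sigma$ be a probability density on $\mathbb R$ (the known error density) with characteristic function $\phi_\sigma=\phi_{\psi_\sigma}$ vanishing nowhere, and supersmooth of order $\beta>0$: for some $\varrho>0$, $\beta_0,\beta_1\in\mathbb R$ and $d_0,d_1>0$, $$d_0|t|^{\beta_0}\exp(-|t|^\beta/\varrho)\le|\phi_\sigma(t)|\le d_1|t|^{\beta_1}\exp(-|t|^\beta/\varrho)\quad\text{for all sufficiently large } t.$$ Let $K:\mathbb R\to\mathbb R$ be an integrable kernel with $\phi_K(0)=1$ and $\phi_K(t)=0$ for $|t|>1$. Let $2\le p<\infty$, $1/p+1/q=1$, and put $\varpi_p(\beta_0)=-(1-1/p)$ if $\beta_0\ge0$ and $\varpi_p(\beta_0)=\beta_0-(1-1/p)$ if $\beta_0<0$. For a sample $W_1,\dots,W_n$ and a bandwidth $h_n>0$ let $$f_{n,X}(x)=\frac1{2\pi}\int_{\mathbb R} e^{-itx}\Big(\frac1n\sum_{j=1}^n e^{itW_j}\Big)\frac{\phi_K(h_nt)}{\phi_\sigma(t)}\,dt,\qquad \widetilde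 K_n(z)=\frac1{2\pi h_n}\int_{\mathbb R} e^{-itz/h_n}\frac{\phi_K(t)}{\phi_\sigma(t/h_n)}\,dt .$$ Then for every $H\in\mathbb R$ there is a constant $C>0$, depending only on $p$, $K$, $\psi_\sigma$, $\beta$, $\beta_0$, $\varrho$ and $H$, such that for every sequence $h_n\to0$ with $0<h_n\le H$ for all $n\ge1$, every probability density $f_X$ and every $n\ge1$, if $W_1,\dots,W_n$ are i.i.d. with density $f_W=f_X\star\psi_\sigma$, then $$n\,E_{f_W}\|f_{n,X}-E_{f_W}f_{n,X}\|_p\le C\,n^{1/2}\,h_n^{\varpi_p(\beta_0)}\exp(h_n^{-\beta}/\varrho).$$ Moreover, with the same $C$, for every countable subset $B_{0q}$ of the unit ball of $L_q(\mathbb R)$ such that $\|s\|_p=\sup_{m\in B_{0q}}|\int s\,m|$ for all $s\in L_p(\mathbb R)$, the class $$\mathcal K_p=\Big\{z\mapsto\int\widetilde K_n(x-z)m(x)\,dx-\int E_{f_W}\{\widetilde K_n(x-W_1)\}\,m(x)\,dx\;:\;m\in B_{0q}\Big\}$$ satisfies $$E_{f_W}\sup_{k\in\mathcal K_p}\Big|\sum_{j=1}^n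 k(W_j)\Big|\le C\,n^{1/2}\,h_n^{\varpi_p(\beta_0)}\exp(h_n^{-\beta}/\varrho).$$ -/

import Mathlib

open MeasureTheory Filter Topology
open scoped ENNReal

noncomputable section

namespace DKE

/-- `f` is a probability density on the real line (with respect to Lebesgue measure). -/
structure IsProbDensity (f : ℝ → ℝ) : Prop where
  measurable : Measurable f
  nonneg : ∀ x, 0 ≤ f x
  integral_eq_one : ∫ x, f x = 1

/-- The Fourier transform `φ_f(t) = ∫ e^{itx} f(x) dx`. -/
def ft (f : ℝ → ℝ) (t : ℝ) : ℂ :=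
  ∫ x : ℝ, Complex.exp (Complex.I * t * x) * (f x : ℂ)

/-- The function `f` is supersmooth of order `β`, with exponents `β₀` (lower bound) and `ϱ`:
for some `β₁` and `d₀, d₁ > 0`, for all large `t`,
`d₀ |t|^β₀ exp(-|t|^β/ϱ) ≤ |φ_f(t)| ≤ d₁ |t|^β₁ exp(-|t|^β/ϱ)`. -/
def IsSupersmooth (f : ℝ → ℝ) (β β₀ ϱ : ℝ) : Prop :=
  0 < β ∧ 0 < ϱ ∧ ∃ β₁ d₀ d₁ : ℝ, 0 < d₀ ∧ 0 < d₁ ∧ ∀ᶠ t : ℝ in atTop,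
    d₀ * |t| ^ β₀ * Real.exp (-(|t| ^ β / ϱ)) ≤ ‖ft f t‖ ∧
      ‖ft f t‖ ≤ d₁ * |t| ^ β₁ * Real.exp (-(|t| ^ β / ϱ))

/-- An integrable real kernel `K` with `φ_K(0) = 1` and `φ_K(t) = 0` for `|t| > 1`. -/
structure IsBandLimitedKernel (K : ℝ → ℝ) : Prop where
  integrable : Integrable K
  ft_zero : ft K 0 = 1
  ft_eq_zero : ∀ t : ℝ, 1 < |t| → ft K t = 0

/-- The empirical characteristic function `φ_{n,W}(t) = n⁻¹ ∑ⱼ e^{itWⱼ}` of a sample. -/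
def empiricalCF {n : ℕ} (w : Fin n → ℝ) (t : ℝ) : ℂ :=
  (1 / (n : ℂ)) * ∑ j, Complex.exp (Complex.I * t * w j)

/-- The deconvoluting kernel estimator
`f_{n,X}(x) = (2π)⁻¹ ∫ e^{-itx} φ_{n,W}(t) φ_K(h t) / φ_ψ(t) dt`
for the error density `ψ`, kernel `K`, bandwidth `h` and sample `w`.
(For real `K` and `ψ` its values are real; they are kept in `ℂ`, as the formula gives them.) -/
def estimator (ψ K : ℝ → ℝ) (h : ℝ) {n : ℕ} (w : Fin n → ℝ) (x : ℝ) : ℂ :=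
  (1 / (2 * Real.pi : ℂ)) *
    ∫ t : ℝ, Complex.exp (-(Complex.I * t * x)) * empiricalCF w t * (ft K (h * t) / ft ψ t)

/-- The deconvoluting kernel `K_n(x) = (2π)⁻¹ ∫ e^{-itx} φ_K(t) / φ_ψ(t/h) dt`. -/
def deconvKernel (ψ K : ℝ → ℝ) (h : ℝ) (x : ℝ) : ℂ :=
  (1 / (2 * Real.pi : ℂ)) *
    ∫ t : ℝ, Complex.exp (-(Complex.I * t * x)) * (ft K t / ft ψ (t / h))

/-- The rescaled kernel `K̃_n(z) = h⁻¹ K_n(z/h)`. -/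
def scaledKernel (ψ K : ℝ → ℝ) (h : ℝ) (z : ℝ) : ℂ :=
  (1 / (h : ℂ)) * deconvKernel ψ K h (z / h)

/-- The density `f_W = f_X ⋆ ψ` of an observation `W = X + U`. -/
def obsDensity (fX ψ : ℝ → ℝ) : ℝ → ℝ :=
  convolution fX ψ (ContinuousLinearMap.mul ℝ ℝ) volume

/-- The law of one observation: the measure with density `f_W = f_X ⋆ ψ`. -/
def obsLaw (fX ψ : ℝ → ℝ) : Measure ℝ :=
  volume.withDensity fun w => ENNReal.ofReal (obsDensity fX ψ w)

/-- The law of an i.i.d. sample `W₁, …, W_n` from `f_W = f_X ⋆ ψ`. -/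
def sampleLaw (fX ψ : ℝ → ℝ) (n : ℕ) : Measure (Fin n → ℝ) :=
  Measure.pi fun _ => obsLaw fX ψ

/-- The pointwise expectation `E_{f_W} f_{n,X}(x)`. -/
def meanEstimator (fX ψ K : ℝ → ℝ) (h : ℝ) (n : ℕ) (x : ℝ) : ℂ :=
  ∫ w : Fin n → ℝ, estimator ψ K h w x ∂(sampleLaw fX ψ n)

/-- `E_{f_W} ‖f_{n,X} - E_{f_W} f_{n,X}‖_p`, as an extended nonnegative number. -/
def expectedDeviation (fX ψ K : ℝ → ℝ) (h p : ℝ) (n : ℕ) : ℝ≥0∞ :=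
  ∫⁻ w : Fin n → ℝ,
    eLpNorm (fun x => estimator ψ K h w x - meanEstimator fX ψ K h n x) (ENNReal.ofReal p) volume
    ∂(sampleLaw fX ψ n)

/-- `B` is a countable subset of the unit ball of `L_q` with
`‖s‖_p = sup_{m ∈ B} |∫ s m|` for every `s ∈ L_p`. -/
structure IsCountableNorming (p q : ℝ) (B : Set (Lp ℝ (ENNReal.ofReal q) (volume : Measure ℝ))) :
    Prop where
  countable : B.Countable
  norm_le_one : ∀ m ∈ B, ‖m‖ ≤ 1
  norming : ∀ s : Lp ℝ (ENNReal.ofReal p) (volume : Measure ℝ),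
    IsLUB ((fun m : Lp ℝ (ENNReal.ofReal q) (volume : Measure ℝ) => |∫ x, s x * m x|) '' B) ‖s‖

/-- The centred function
`z ↦ ∫ K̃_n(x - z) m(x) dx - ∫ E_{f_W}{K̃_n(x - W₁)} m(x) dx`. -/
def centredFun (fX ψ K : ℝ → ℝ) (h : ℝ) (m : ℝ → ℝ) (z : ℝ) : ℂ :=
  (∫ x, scaledKernel ψ K h (x - z) * (m x : ℂ)) -
    ∫ x, (∫ w, scaledKernel ψ K h (x - w) ∂(obsLaw fX ψ)) * (m x : ℂ)

/-- The class `𝒦_p` of all centred functions, `m` ranging over `B`. -/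
def kernelClass (fX ψ K : ℝ → ℝ) (h q : ℝ)
    (B : Set (Lp ℝ (ENNReal.ofReal q) (volume : Measure ℝ))) : Set (ℝ → ℂ) :=
  {k | ∃ m ∈ B, k = centredFun fX ψ K h m}

/-- `E_{f_W} sup_{k ∈ 𝒢} |∑ⱼ k(Wⱼ)|`, the expected supremum of `n` times the empirical measure
over the class `𝒢`. -/
def expectedSup (fX ψ : ℝ → ℝ) (n : ℕ) (𝒢 : Set (ℝ → ℂ)) : ℝ≥0∞ :=
  ∫⁻ w : Fin n → ℝ, ⨆ k ∈ 𝒢, ‖∑ j, k (w j)‖ₑ ∂(sampleLaw fX ψ n)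

/-- `ϖ_p(β₀) = -(1 - 1/p)` if `β₀ ≥ 0`, and `β₀ - (1 - 1/p)` if `β₀ < 0`. -/
def varpi (p β₀ : ℝ) : ℝ :=
  if 0 ≤ β₀ then -(1 - 1 / p) else β₀ - (1 - 1 / p)

end DKE

end

namespace DKE

/-! Write `k` for the rescaled kernel. By linearity, `n` times the centred estimator is the sum of
the independent centred functions `k(· - Wⱼ) - E k(· - W)`. Pairing this sum with `m` gives the sum
of an element of the class, so by Hölder the supremum over the class is at most its `L_p` norm. Both
claims thus follow from one bound, E‖sum‖_p ≤ 2 √(2cn) ‖k‖_p.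

For that bound, Jensen and Tonelli reduce the `p`-th power to ∫ E|sum at x|^p dx. For each `x` the
sum is one of bounded centred i.i.d. variables, and `integral_norm_sum_rpow_le` gives a factor of
order n^{p/2}. Integrating ∫ |k(x - w)|^p dμ(w) over `x` leaves ‖k‖_p^p by translation invariance,
so the law of the sample disappears and the constant does not depend on `fX`.

The kernel is the inverse Fourier transform of φ_K(ht)/φ_ψ(t), which lives on |t| ≤ R = 1/h and is
bounded there by some A. The trivial sup bound AR and Plancherel's bound of order A√R interpolate to
‖k‖_p ≤ A R^{1-1/p} (`eLpNorm_invFT_le`). Supersmoothness bounds A by a constant times h^{min(β₀,0)}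
exp(h^{-β}/ϱ) (`exists_inv_norm_ft_le`). -/

/-! ### Plancherel's identity for the Fourier integral -/

theorem continuous_fourier_of_integrable {g : ℝ → ℂ} (h1 : Integrable g) :
    Continuous (FourierTransform.fourier g : ℝ → ℂ) :=
  VectorFourier.fourierIntegral_continuous (L := innerₗ ℝ) (μ := volume)
    Real.continuous_fourierChar (by exact continuous_inner) h1

open FourierTransform SchwartzMap in
theorem integral_fourier_schwartz_smul {g : ℝ → ℂ} (h1 : Integrable g) (Φ : 𝓢(ℝ, ℂ)) :
    ∫ x, (𝓕 Φ) x • g x = ∫ x, Φ x • 𝓕 g x := by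
  have := VectorFourier.integral_fourierIntegral_smul_eq_flip (L := innerₗ ℝ)
    (f := Φ) (g := g) (μ := volume) (ν := volume) Real.continuous_fourierChar
    (by exact continuous_inner) Φ.integrable h1
  rw [flip_innerₗ] at this
  exact this

open FourierTransform SchwartzMap in
-- The `L²` transform agrees with the distributional one, which moves onto the test function; the
-- Fourier integral of `g` does the same by Fubini.
theorem integral_schwartz_smul_fourier_toLp {g : ℝ → ℂ} (h1 : Integrable g) (h2 : MemLp g 2)
    (Φ : 𝓢(ℝ, ℂ)) :
    ∫ x, Φ x • (𝓕 (h2.toLp g) : Lp (α := ℝ) ℂ 2) x = ∫ x, Φ x • 𝓕 g x := by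
  have e1 := congrArg (fun T => T Φ) (Lp.fourier_toTemperedDistribution_eq (h2.toLp g))
  simp only [TemperedDistribution.fourier_apply, Lp.toTemperedDistribution_apply] at e1
  have e3 : ∫ x, (𝓕 Φ) x • (h2.toLp g) x = ∫ x, (𝓕 Φ) x • g x := by
    refine integral_congr_ae ?_
    filter_upwards [h2.coeFn_toLp] with x hx
    rw [hx]
  exact e1.symm.trans (e3.trans (integral_fourier_schwartz_smul h1 Φ))

open FourierTransform SchwartzMap in
/-- Plancherel's identity for integrable, square integrable functions on the line. -/
theorem eLpNorm_fourier_two {g : ℝ → ℂ} (h1 : Integrable g) (h2 : MemLp g 2) :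
    eLpNorm (𝓕 g) 2 = eLpNorm g 2 := by
  set G : Lp (α := ℝ) ℂ 2 := h2.toLp g with hG
  have key : ∀ᵐ x, (𝓕 G) x = 𝓕 g x := by
    -- Smooth compactly supported functions are Schwartz and separate locally integrable functions
    -- up to null sets.
    refine ae_eq_of_integral_contDiff_smul_eq ((Lp.memLp _).locallyIntegrable (by norm_num))
      (continuous_fourier_of_integrable h1).locallyIntegrable fun φ hφ hφc => ?_
    have hcs : HasCompactSupport (fun x => (φ x : ℂ)) :=
      hφc.comp_left (g := ((↑) : ℝ → ℂ)) Complex.ofReal_zero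
    have hsm : ContDiff ℝ (⊤ : ℕ∞) (fun x => (φ x : ℂ)) :=
      Complex.ofRealCLM.contDiff.comp hφ
    have := integral_schwartz_smul_fourier_toLp h1 h2 (hcs.toSchwartzMap hsm)
    simp only [smul_eq_mul] at this
    simp only [Complex.real_smul]
    exact this
  rw [← eLpNorm_congr_ae key, ← Lp.enorm_def, ← ofReal_norm, Lp.norm_fourier_eq, ofReal_norm,
    hG, Lp.enorm_toLp]

/-! ### Moment inequality for centred i.i.d. sums -/

/-- Second order expansion of `‖·‖ ^ p`, with remainder, in a real inner product space. -/
theorem exists_norm_add_rpow_le {E : Type*} [NormedAddCommGroup E] [InnerProductSpace ℝ E]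
    {p : ℝ} (hp : 2 ≤ p) :
    ∃ c : ℝ, 1 ≤ c ∧ ∀ a b : E, ‖a + b‖ ^ p ≤
      ‖a‖ ^ p + p * ‖a‖ ^ (p - 2) * inner ℝ a b + c * (‖a‖ ^ (p - 2) * ‖b‖ ^ 2 + ‖b‖ ^ p) := by
  obtain ⟨r, hr, rfl⟩ : ∃ r : ℝ, 1 ≤ r ∧ p = 2 * r := ⟨p / 2, by linarith, by ring⟩
  have hC : 0 ≤ (3 * r + 1) ^ (2 * r) + 2 * r * (3 * r) ^ (2 * r - 2) * (3 * r) := by positivity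
  refine ⟨(r + 9 * r ^ 2) + ((3 * r + 1) ^ (2 * r) + 2 * r * (3 * r) ^ (2 * r - 2) * (3 * r)),
    by nlinarith, fun a b => ?_⟩
  have hin : |inner ℝ a b| ≤ ‖a‖ * ‖b‖ := abs_real_inner_le_norm a b
  have hN := norm_nonneg a
  have hB := norm_nonneg b
  generalize hC' : (3 * r + 1) ^ (2 * r) + 2 * r * (3 * r) ^ (2 * r - 2) * (3 * r) = C at hC ⊢
  have hq : 0 ≤ ‖a‖ ^ (2 * r - 2) := by positivity
  have hbp : 0 ≤ ‖b‖ ^ (2 * r) := by positivity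
  have hqb : 0 ≤ ‖a‖ ^ (2 * r - 2) * ‖b‖ ^ 2 := by positivity
  -- The threshold `3r` makes |rx| ≤ 1 below, where ‖a+b‖² = ‖a‖²(1+x), so the quadratic bound for
  -- the exponential applies.
  rcases le_or_gt (3 * r * ‖b‖) ‖a‖ with h | h
  · rcases hN.eq_or_lt with h0 | h0
    · have hb : b = 0 := by
        rw [← norm_le_zero_iff]; nlinarith
      have ha : a = 0 := norm_le_zero_iff.1 h0.ge
      subst ha hb
      simp [Real.zero_rpow (show 2 * r ≠ 0 by positivity)]
    · set x : ℝ := (2 * inner ℝ a b + ‖b‖ ^ 2) / ‖a‖ ^ 2 with hx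
      have hN2 : 0 < ‖a‖ ^ 2 := by positivity
      have hxN : x * ‖a‖ ^ 2 = 2 * inner ℝ a b + ‖b‖ ^ 2 := by
        rw [hx, div_mul_cancel₀ _ hN2.ne']
      have hb1 : ‖b‖ ≤ ‖a‖ := by nlinarith
      have hv : |2 * inner ℝ a b + ‖b‖ ^ 2| ≤ 3 * ‖a‖ * ‖b‖ := by
        rw [abs_le] at hin ⊢
        constructor <;> nlinarith
      have hrx : |r * x| ≤ 1 := by
        rw [hx, abs_mul, abs_div, abs_of_pos hN2, abs_of_pos (by linarith : 0 < r), ← mul_div_assoc,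
          div_le_one hN2]
        nlinarith
      have hxsq : x ^ 2 * ‖a‖ ^ 2 ≤ 9 * ‖b‖ ^ 2 := by
        have h4 : (x * ‖a‖ ^ 2) ^ 2 ≤ (3 * ‖a‖ * ‖b‖) ^ 2 := by
          rw [hxN]; exact sq_le_sq' (abs_le.1 hv).1 (abs_le.1 hv).2
        have h5 : (x ^ 2 * ‖a‖ ^ 2) * ‖a‖ ^ 2 ≤ (9 * ‖b‖ ^ 2) * ‖a‖ ^ 2 := by nlinarith
        exact le_of_mul_le_mul_right h5 hN2
      have hsq : ‖a + b‖ ^ 2 = ‖a‖ ^ 2 * (1 + x) := by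
        rw [norm_add_sq_real]; linarith
      have h1x : 0 ≤ 1 + x := by
        have : 0 ≤ ‖a‖ ^ 2 * (1 + x) := by rw [← hsq]; positivity
        exact nonneg_of_mul_nonneg_right this hN2
      have hpw : ∀ y : ℝ, 0 ≤ y → y ^ (2 * r) = (y ^ 2) ^ r := fun y hy => by
        rw [Real.rpow_mul hy, Real.rpow_two]
      have hsplit : ‖a‖ ^ (2 * r) = ‖a‖ ^ (2 * r - 2) * ‖a‖ ^ 2 := by
        rw [← Real.rpow_two ‖a‖, ← Real.rpow_add h0]; congr 1; ring
      -- Since 1 + x ≤ eˣ, the power is at most e^{rx}. The linear term `rx` yields the inner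
      -- product plus `r‖a‖^(p-2)‖b‖²`, the square yields the `9r²` part of the constant.
      have hexp : (1 + x) ^ r ≤ 1 + r * x + (r * x) ^ 2 := by
        calc (1 + x) ^ r ≤ (Real.exp x) ^ r :=
              Real.rpow_le_rpow h1x (by linarith [Real.add_one_le_exp x]) (by linarith)
          _ = Real.exp (r * x) := by rw [← Real.exp_mul, mul_comm]
          _ ≤ _ := by
              have := (abs_le.1 (Real.abs_exp_sub_one_sub_id_le hrx)).2
              linarith
      have hmain : ‖a + b‖ ^ (2 * r) ≤ ‖a‖ ^ (2 * r) * (1 + r * x + (r * x) ^ 2) := by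
        rw [hpw _ (norm_nonneg _), hsq, Real.mul_rpow hN2.le h1x, ← hpw _ hN]
        gcongr
      have e : ‖a‖ ^ (2 * r) * (1 + r * x + (r * x) ^ 2) =
          ‖a‖ ^ (2 * r) + r * ‖a‖ ^ (2 * r - 2) * (x * ‖a‖ ^ 2) +
            r ^ 2 * (‖a‖ ^ (2 * r - 2) * (x ^ 2 * ‖a‖ ^ 2)) := by
        rw [hsplit]; ring
      rw [hxN] at e
      have h6 : r ^ 2 * (‖a‖ ^ (2 * r - 2) * (x ^ 2 * ‖a‖ ^ 2)) ≤
          r ^ 2 * (‖a‖ ^ (2 * r - 2) * (9 * ‖b‖ ^ 2)) := by gcongr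
      have h7 : 0 ≤ (r + 9 * r ^ 2) * ‖b‖ ^ (2 * r) := by positivity
      have h8 : 0 ≤ C * (‖a‖ ^ (2 * r - 2) * ‖b‖ ^ 2 + ‖b‖ ^ (2 * r)) := by positivity
      linarith
  -- Here `‖a‖ < 3r‖b‖`, so the left side and the possibly negative inner product term are both
  -- multiples of `‖b‖^p`; the constant `C` is the sum of the two factors.
  · have hb0 : 0 < ‖b‖ := by nlinarith
    have hsplit : ‖b‖ ^ (2 * r) = ‖b‖ ^ (2 * r - 2) * ‖b‖ ^ 2 := by
      rw [← Real.rpow_two ‖b‖, ← Real.rpow_add hb0]; congr 1; ring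
    have h1 : ‖a + b‖ ^ (2 * r) ≤ (3 * r + 1) ^ (2 * r) * ‖b‖ ^ (2 * r) := by
      rw [← Real.mul_rpow (by linarith) hB]
      refine Real.rpow_le_rpow (norm_nonneg _) ?_ (by linarith)
      linarith [norm_add_le a b]
    have h2 : ‖a‖ ^ (2 * r - 2) * (‖a‖ * ‖b‖) ≤
        (3 * r) ^ (2 * r - 2) * (3 * r) * ‖b‖ ^ (2 * r) := by
      calc ‖a‖ ^ (2 * r - 2) * (‖a‖ * ‖b‖)
          ≤ (3 * r * ‖b‖) ^ (2 * r - 2) * ((3 * r * ‖b‖) * ‖b‖) := by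
            gcongr
        _ = _ := by rw [Real.mul_rpow (by linarith) hB, hsplit]; ring
    have h3 : -(‖a‖ ^ (2 * r - 2) * (‖a‖ * ‖b‖)) ≤ ‖a‖ ^ (2 * r - 2) * inner ℝ a b := by
      rw [← mul_neg]
      exact mul_le_mul_of_nonneg_left (abs_le.1 hin).1 hq
    have h4 : 0 ≤ ‖a‖ ^ (2 * r) := by positivity
    have h5 : 0 ≤ (r + 9 * r ^ 2) * (‖a‖ ^ (2 * r - 2) * ‖b‖ ^ 2 + ‖b‖ ^ (2 * r)) := by positivity
    have h6 : 0 ≤ C * (‖a‖ ^ (2 * r - 2) * ‖b‖ ^ 2) := by positivity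
    have h7 := mul_le_mul_of_nonneg_left (h3.trans' (neg_le_neg h2))
      (by linarith : 0 ≤ 2 * r)
    have h8 : C * ‖b‖ ^ (2 * r) = (3 * r + 1) ^ (2 * r) * ‖b‖ ^ (2 * r) +
      2 * r * ((3 * r) ^ (2 * r - 2) * (3 * r) * ‖b‖ ^ (2 * r)) := by rw [← hC']; ring
    linarith

/-- Jensen's inequality for the concave power `θ ∈ [0, 1]`. -/
theorem integral_rpow_le_rpow_integral {α : Type*} [MeasurableSpace α] {μ : Measure α}
    [IsProbabilityMeasure μ] {f : α → ℝ} (hf : Integrable f μ) (h0 : ∀ x, 0 ≤ f x) {θ : ℝ}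
    (hθ0 : 0 ≤ θ) (hθ1 : θ ≤ 1) : ∫ x, f x ^ θ ∂μ ≤ (∫ x, f x ∂μ) ^ θ := by
  refine (Real.concaveOn_rpow hθ0 hθ1).le_map_integral
    (Real.continuous_rpow_const hθ0).continuousOn isClosed_Ici
    (ae_of_all _ h0) hf ?_
  refine Integrable.mono' (hf.add (integrable_const 1))
    ((Real.continuous_rpow_const hθ0).comp_aestronglyMeasurable hf.aestronglyMeasurable)
    (ae_of_all _ fun x => ?_)
  have hn : 0 ≤ f x ^ θ := Real.rpow_nonneg (h0 x) _
  simp only [Function.comp_apply, Real.norm_of_nonneg hn, Pi.add_apply]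
  rcases le_total (f x) 1 with h | h
  · linarith [Real.rpow_le_one (h0 x) h hθ0, h0 x]
  · linarith [(Real.rpow_le_rpow_of_exponent_le h hθ1).trans_eq (Real.rpow_one _)]

/-- Integrating the expansion about the fixed `a` kills the first order term because `Y` is centred.
Jensen turns the second moment into the `p`-th one, so that a single moment is carried through the
induction. -/
theorem integral_norm_add_rpow_le {α : Type*} [MeasurableSpace α] {μ : Measure α}
    [IsProbabilityMeasure μ] {p c : ℝ} (hp : 2 ≤ p) (hc1 : 1 ≤ c)
    (hc : ∀ a b : ℂ, ‖a + b‖ ^ p ≤ ‖a‖ ^ p + p * ‖a‖ ^ (p - 2) * inner ℝ a b +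
      c * (‖a‖ ^ (p - 2) * ‖b‖ ^ 2 + ‖b‖ ^ p))
    {Y : α → ℂ} (hY : Measurable Y) {M : ℝ} (hM : ∀ x, ‖Y x‖ ≤ M) (h0 : ∫ x, Y x ∂μ = 0) (a : ℂ) :
    ∫ x, ‖a + Y x‖ ^ p ∂μ ≤ ‖a‖ ^ p +
      c * (‖a‖ ^ (p - 2) * (∫ x, ‖Y x‖ ^ p ∂μ) ^ (2 / p) + ∫ x, ‖Y x‖ ^ p ∂μ) := by
  have hp0 : 0 < p := by linarith
  have iY : Integrable Y μ := .of_bound hY.aestronglyMeasurable M (ae_of_all _ hM)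
  have iin : Integrable (fun x => inner ℝ a (Y x)) μ := iY.const_inner a
  have ip : Integrable (fun x => ‖Y x‖ ^ p) μ := by
    refine .of_bound (hY.norm.pow_const p).aestronglyMeasurable (M ^ p) (ae_of_all _ fun x => ?_)
    rw [Real.norm_of_nonneg (by positivity)]
    exact Real.rpow_le_rpow (norm_nonneg _) (hM x) hp0.le
  have i2 : Integrable (fun x => ‖Y x‖ ^ 2) μ := by
    refine .of_bound (hY.norm.pow_const 2).aestronglyMeasurable (M ^ 2) (ae_of_all _ fun x => ?_)
    rw [Real.norm_of_nonneg (by positivity)]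
    gcongr
    exact hM x
  have ia : Integrable (fun x => ‖a + Y x‖ ^ p) μ := by
    refine .of_bound ((hY.const_add a).norm.pow_const p).aestronglyMeasurable ((‖a‖ + M) ^ p)
      (ae_of_all _ fun x => ?_)
    rw [Real.norm_of_nonneg (by positivity)]
    exact Real.rpow_le_rpow (norm_nonneg _) ((norm_add_le _ _).trans (by gcongr; exact hM x)) hp0.le
  have hin0 : ∫ x, inner ℝ a (Y x) ∂μ = 0 := by
    rw [integral_inner iY, h0, inner_zero_right]
  have hJ : ∫ x, ‖Y x‖ ^ 2 ∂μ ≤ (∫ x, ‖Y x‖ ^ p ∂μ) ^ (2 / p) := by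
    have := integral_rpow_le_rpow_integral ip (fun x => by positivity)
      (θ := 2 / p) (by positivity) ((div_le_one hp0).2 hp)
    refine le_trans (le_of_eq ?_) this
    refine integral_congr_ae (ae_of_all _ fun x => ?_)
    simp only
    rw [← Real.rpow_mul (norm_nonneg _), mul_div_cancel₀ _ hp0.ne', Real.rpow_two]
  have j1 : Integrable (fun x => ‖a‖ ^ p + p * ‖a‖ ^ (p - 2) * inner ℝ a (Y x)) μ :=
    (integrable_const _).add (iin.const_mul _)
  have j2 : Integrable (fun x => ‖a‖ ^ (p - 2) * ‖Y x‖ ^ 2 + ‖Y x‖ ^ p) μ :=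
    (i2.const_mul _).add ip
  calc ∫ x, ‖a + Y x‖ ^ p ∂μ
      ≤ ∫ x, (‖a‖ ^ p + p * ‖a‖ ^ (p - 2) * inner ℝ a (Y x) +
        c * (‖a‖ ^ (p - 2) * ‖Y x‖ ^ 2 + ‖Y x‖ ^ p)) ∂μ := by
        exact integral_mono ia (j1.add (j2.const_mul c)) fun x => hc a (Y x)
    _ = ‖a‖ ^ p + c * (‖a‖ ^ (p - 2) * ∫ x, ‖Y x‖ ^ 2 ∂μ + ∫ x, ‖Y x‖ ^ p ∂μ) := by
        rw [integral_add j1 (j2.const_mul c), integral_add (integrable_const _)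
          (iin.const_mul _), integral_const_mul, integral_const_mul,
          integral_add (i2.const_mul _) ip, integral_const_mul, hin0]
        simp
    _ ≤ _ := by gcongr

/-- A Marcinkiewicz–Zygmund type moment inequality for sums of bounded centred i.i.d. variables. -/
theorem integral_norm_sum_rpow_le {α : Type*} [MeasurableSpace α] {μ : Measure α}
    [IsProbabilityMeasure μ] {p c : ℝ} (hp : 2 ≤ p) (hc1 : 1 ≤ c)
    (hc : ∀ a b : ℂ, ‖a + b‖ ^ p ≤ ‖a‖ ^ p + p * ‖a‖ ^ (p - 2) * inner ℝ a b +
      c * (‖a‖ ^ (p - 2) * ‖b‖ ^ 2 + ‖b‖ ^ p))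
    {Y : α → ℂ} (hY : Measurable Y) {M : ℝ} (hM : ∀ x, ‖Y x‖ ≤ M) (h0 : ∫ x, Y x ∂μ = 0) (n : ℕ) :
    ∫ w : Fin n → α, ‖∑ j, Y (w j)‖ ^ p ∂(Measure.pi fun _ => μ) ≤
      (2 * c * n) ^ (p / 2) * ∫ x, ‖Y x‖ ^ p ∂μ := by
  have hp0 : 0 < p := by linarith
  set m := ∫ x, ‖Y x‖ ^ p ∂μ with hm
  have hm0 : 0 ≤ m := integral_nonneg fun x => by positivity
  induction n with
  | zero => simp [Real.zero_rpow hp0.ne', Real.zero_rpow (half_pos hp0).ne']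
  | succ n ih =>
    set ν : Measure (Fin n → α) := Measure.pi fun _ => μ with hν
    set S : (Fin n → α) → ℂ := fun w => ∑ j, Y (w j) with hS
    set A := ∫ w, ‖S w‖ ^ p ∂ν with hA
    have hA0 : 0 ≤ A := integral_nonneg fun x => by positivity
    have mS : Measurable S := by fun_prop
    have bS : ∀ w, ‖S w‖ ≤ n * M := fun w => by
      refine (norm_sum_le _ _).trans ((Finset.sum_le_sum fun j _ => hM (w j)).trans ?_)
      simp
    have iS : Integrable (fun w => ‖S w‖ ^ p) ν := by
      refine .of_bound (mS.norm.pow_const p).aestronglyMeasurable ((n * M) ^ p)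
        (ae_of_all _ fun x => ?_)
      rw [Real.norm_of_nonneg (by positivity)]
      exact Real.rpow_le_rpow (norm_nonneg _) (bS x) hp0.le
    have iS2 : Integrable (fun w => ‖S w‖ ^ (p - 2)) ν := by
      refine .of_bound (mS.norm.pow_const _).aestronglyMeasurable ((n * M) ^ (p - 2))
        (ae_of_all _ fun x => ?_)
      rw [Real.norm_of_nonneg (by positivity)]
      exact Real.rpow_le_rpow (norm_nonneg _) (bS x) (by linarith)
    have mF : Measurable fun z : α × (Fin n → α) => ‖S z.2 + Y z.1‖ ^ p := by fun_prop
    have iF : Integrable (fun z : α × (Fin n → α) => ‖S z.2 + Y z.1‖ ^ p) (μ.prod ν) := by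
      refine .of_bound mF.aestronglyMeasurable ((n * M + M) ^ p) (ae_of_all _ fun x => ?_)
      rw [Real.norm_of_nonneg (by positivity)]
      refine Real.rpow_le_rpow (norm_nonneg _) ?_ hp0.le
      exact (norm_add_le _ _).trans (add_le_add (bS _) (hM _))
    -- Fubini separates one coordinate; with the others fixed, their sum is the constant `a` of the
    -- one-step bound.
    have e1 : ∫ w : Fin (n + 1) → α, ‖∑ j, Y (w j)‖ ^ p ∂(Measure.pi fun _ => μ) =
        ∫ w, ∫ x, ‖S w + Y x‖ ^ p ∂μ ∂ν := by
      rw [← integral_prod_symm _ iF]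
      rw [← (measurePreserving_piFinSuccAbove (fun _ : Fin (n + 1) => μ) 0).integral_comp'
        (fun z : α × (Fin n → α) => ‖S z.2 + Y z.1‖ ^ p)]
      refine integral_congr_ae (ae_of_all _ fun w => ?_)
      simp [hS, Fin.sum_univ_succ, add_comm, Fin.tail]
    have hJ : ∫ w, ‖S w‖ ^ (p - 2) ∂ν ≤ A ^ ((p - 2) / p) := by
      have := integral_rpow_le_rpow_integral iS (fun x => by positivity)
        (θ := (p - 2) / p) (by apply div_nonneg <;> linarith) ((div_le_one hp0).2 (by linarith))
      refine le_trans (le_of_eq ?_) this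
      refine integral_congr_ae (ae_of_all _ fun x => ?_)
      simp only
      rw [← Real.rpow_mul (norm_nonneg _), mul_div_cancel₀ _ hp0.ne']
    have jS : Integrable (fun w => ‖S w‖ ^ (p - 2) * m ^ (2 / p) + m) ν :=
      (iS2.mul_const _).add (integrable_const _)
    have e2 : ∫ w, ∫ x, ‖S w + Y x‖ ^ p ∂μ ∂ν ≤
        A + c * (A ^ ((p - 2) / p) * m ^ (2 / p) + m) := by
      calc _ ≤ ∫ w, (‖S w‖ ^ p + c * (‖S w‖ ^ (p - 2) * m ^ (2 / p) + m)) ∂ν :=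
            integral_mono iF.integral_prod_right
              (iS.add (jS.const_mul c))
              fun w => integral_norm_add_rpow_le hp hc1 hc hY hM h0 (S w)
        _ = A + c * ((∫ w, ‖S w‖ ^ (p - 2) ∂ν) * m ^ (2 / p) + m) := by
            rw [integral_add iS (jS.const_mul c),
              integral_const_mul, integral_add (iS2.mul_const _) (integrable_const _),
              integral_mul_const]
            simp [hA]
        _ ≤ _ := by gcongr
    rw [e1]
    refine e2.trans ?_
    set x : ℝ := 2 * c * n with hx
    have hx0 : 0 ≤ x := by positivity
    have hAm : A ^ ((p - 2) / p) * m ^ (2 / p) ≤ x ^ (p / 2 - 1) * m := by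
      calc A ^ ((p - 2) / p) * m ^ (2 / p)
          ≤ (x ^ (p / 2) * m) ^ ((p - 2) / p) * m ^ (2 / p) := by
            gcongr
        _ = x ^ (p / 2 - 1) * (m ^ ((p - 2) / p) * m ^ (2 / p)) := by
            rw [Real.mul_rpow (by positivity) hm0, ← Real.rpow_mul hx0, mul_assoc]
            congr 2
            field_simp
        _ = x ^ (p / 2 - 1) * m := by
            have h1 : (p - 2) / p + 2 / p = 1 := by field_simp; ring
            rw [← Real.rpow_add' hm0 (by rw [h1]; exact one_ne_zero), h1, Real.rpow_one]
    have hy1 : 1 ≤ x + 2 * c := by linarith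
    have hadd : p / 2 = 1 + (p / 2 - 1) := by ring
    have hr : 0 ≤ p / 2 - 1 := by linarith
    have h1 : x ^ (p / 2) = x * x ^ (p / 2 - 1) := by
      conv_lhs => rw [hadd]
      rw [Real.rpow_add' hx0 (by linarith), Real.rpow_one]
    have h2 : (x + 2 * c) ^ (p / 2) = (x + 2 * c) * (x + 2 * c) ^ (p / 2 - 1) := by
      conv_lhs => rw [hadd]
      rw [Real.rpow_add' (by linarith) (by linarith), Real.rpow_one]
    have h3 : x ^ (p / 2 - 1) ≤ (x + 2 * c) ^ (p / 2 - 1) :=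
      Real.rpow_le_rpow hx0 (by linarith) hr
    have h4 : 1 ≤ (x + 2 * c) ^ (p / 2 - 1) := Real.one_le_rpow hy1 hr
    -- This closes the induction and explains the `2c`: writing y = x + 2c, the surplus 2c·y^{p/2-1}
    -- pays once for c·x^{p/2-1} and once for c, the latter because y ≥ 1.
    have h5 : x ^ (p / 2) + c * (x ^ (p / 2 - 1) + 1) ≤ (x + 2 * c) ^ (p / 2) := by
      rw [h1, h2]
      nlinarith [mul_le_mul_of_nonneg_left h3 hx0]
    have h6 : 2 * c * ((n + 1 : ℕ) : ℝ) = x + 2 * c := by push_cast; ring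
    rw [h6]
    calc A + c * (A ^ ((p - 2) / p) * m ^ (2 / p) + m)
        ≤ x ^ (p / 2) * m + c * (x ^ (p / 2 - 1) * m + m) := by gcongr
      _ = (x ^ (p / 2) + c * (x ^ (p / 2 - 1) + 1)) * m := by ring
      _ ≤ _ := by gcongr

/-! ### Jensen and centring for extended nonnegative integrals -/

theorem enorm_rpow_eq_ofReal {E : Type*} [NormedAddCommGroup E] (a : E) {p : ℝ} (hp : 0 ≤ p) :
    ‖a‖ₑ ^ p = ENNReal.ofReal (‖a‖ ^ p) := by
  rw [← ofReal_norm, ENNReal.ofReal_rpow_of_nonneg (norm_nonneg _) hp]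

theorem eLpNorm_ofReal_rpow {α E : Type*} [MeasurableSpace α] {μ : Measure α}
    [NormedAddCommGroup E] {p : ℝ} (hp : 0 < p) (f : α → E) :
    eLpNorm f (ENNReal.ofReal p) μ ^ p = ∫⁻ x, ‖f x‖ₑ ^ p ∂μ := by
  rw [eLpNorm_eq_lintegral_rpow_enorm_toReal (by simpa using hp) ENNReal.ofReal_ne_top,
    ENNReal.toReal_ofReal hp.le, ← ENNReal.rpow_mul, one_div_mul_cancel hp.ne', ENNReal.rpow_one]

theorem lintegral_rpow_le_lintegral_rpow {α : Type*} [MeasurableSpace α] {μ : Measure α}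
    [IsProbabilityMeasure μ] {f : α → ℝ≥0∞} (hf : AEMeasurable f μ) {p : ℝ} (hp : 1 ≤ p) :
    (∫⁻ x, f x ∂μ) ^ p ≤ ∫⁻ x, f x ^ p ∂μ := by
  have h := eLpNorm_le_eLpNorm_of_exponent_le (μ := μ) (f := f) (p := 1) (q := ENNReal.ofReal p)
    (by simpa using hp) hf.aestronglyMeasurable
  rw [eLpNorm_one_eq_lintegral_enorm, eLpNorm_eq_lintegral_rpow_enorm_toReal
    (by simp; linarith) ENNReal.ofReal_ne_top, ENNReal.toReal_ofReal (by linarith)] at h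
  simp only [enorm_eq_self] at h
  calc _ ≤ ((∫⁻ x, f x ^ p ∂μ) ^ (1 / p)) ^ p := by gcongr
    _ = _ := by rw [← ENNReal.rpow_mul, one_div_mul_cancel (by linarith), ENNReal.rpow_one]

theorem enorm_integral_rpow_le {α : Type*} [MeasurableSpace α] {μ : Measure α}
    [IsProbabilityMeasure μ] {f : α → ℂ} (hf : Measurable f) {p : ℝ} (hp : 1 ≤ p) :
    ‖∫ x, f x ∂μ‖ₑ ^ p ≤ ∫⁻ x, ‖f x‖ₑ ^ p ∂μ :=
  (ENNReal.rpow_le_rpow (enorm_integral_le_lintegral_enorm f) (by linarith)).trans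
    (lintegral_rpow_le_lintegral_rpow hf.enorm.aemeasurable hp)

theorem lintegral_enorm_sub_integral_rpow_le {α : Type*} [MeasurableSpace α] {μ : Measure α}
    [IsProbabilityMeasure μ] {f : α → ℂ} (hf : Measurable f) {p : ℝ} (hp : 1 ≤ p) :
    ∫⁻ x, ‖f x - ∫ y, f y ∂μ‖ₑ ^ p ∂μ ≤ 2 ^ p * ∫⁻ x, ‖f x‖ₑ ^ p ∂μ := by
  calc ∫⁻ x, ‖f x - ∫ y, f y ∂μ‖ₑ ^ p ∂μ
      ≤ ∫⁻ x, 2 ^ (p - 1) * (‖f x‖ₑ ^ p + ‖∫ y, f y ∂μ‖ₑ ^ p) ∂μ := by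
        refine lintegral_mono fun x => ?_
        exact (ENNReal.rpow_le_rpow enorm_sub_le (by linarith)).trans
          (ENNReal.rpow_add_le_mul_rpow_add_rpow _ _ hp)
    _ = 2 ^ (p - 1) * ((∫⁻ x, ‖f x‖ₑ ^ p ∂μ) + ‖∫ y, f y ∂μ‖ₑ ^ p) := by
        rw [lintegral_const_mul _ (by fun_prop), lintegral_add_right _ measurable_const]
        simp
    _ ≤ 2 ^ (p - 1) * ((∫⁻ x, ‖f x‖ₑ ^ p ∂μ) + ∫⁻ x, ‖f x‖ₑ ^ p ∂μ) := by
        gcongr; exact enorm_integral_rpow_le hf hp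
    _ = 2 ^ p * ∫⁻ x, ‖f x‖ₑ ^ p ∂μ := by
        rw [← two_mul, ← mul_assoc]
        congr 1
        have h := ENNReal.rpow_add (x := 2) (p - 1) 1 (by norm_num) (by norm_num)
        rw [ENNReal.rpow_one, sub_add_cancel] at h
        exact h.symm

/-! ### Centred sums of translates of a kernel -/

/-- The expected value `x ↦ E k(x - W)` of a translated kernel. -/
noncomputable def meanKernel (k : ℝ → ℂ) (μ : Measure ℝ) (x : ℝ) : ℂ := ∫ w, k (x - w) ∂μ

theorem measurable_meanKernel {k : ℝ → ℂ} (hk : Measurable k) (μ : Measure ℝ) [SFinite μ] :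
    Measurable (meanKernel k μ) := by
  have : StronglyMeasurable (Function.uncurry fun x w : ℝ => k (x - w)) :=
    (hk.comp (measurable_fst.sub measurable_snd)).stronglyMeasurable
  exact this.integral_prod_right.measurable

/-- Tonelli and translation invariance: this is where the law `μ` drops out of the bound. -/
theorem lintegral_lintegral_translate {k : ℝ → ℂ} (hk : Measurable k) (μ : Measure ℝ)
    [IsProbabilityMeasure μ] (p : ℝ) :
    ∫⁻ x, ∫⁻ w, ‖k (x - w)‖ₑ ^ p ∂μ = ∫⁻ x, ‖k x‖ₑ ^ p := by
  rw [lintegral_lintegral_swap (by fun_prop)]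
  simp [lintegral_sub_right_eq_self (fun x => ‖k x‖ₑ ^ p)]

theorem memLp_meanKernel {k : ℝ → ℂ} (hk : Measurable k) (μ : Measure ℝ)
    [IsProbabilityMeasure μ] {p : ℝ} (hp : 1 ≤ p) (hkp : MemLp k (ENNReal.ofReal p)) :
    MemLp (meanKernel k μ) (ENNReal.ofReal p) := by
  have hp0 : 0 < p := by linarith
  refine ⟨(measurable_meanKernel hk μ).aestronglyMeasurable, ?_⟩
  rw [← ENNReal.rpow_lt_top_iff_of_pos hp0, eLpNorm_ofReal_rpow hp0]
  calc ∫⁻ x, ‖meanKernel k μ x‖ₑ ^ p ≤ ∫⁻ x, ∫⁻ w, ‖k (x - w)‖ₑ ^ p ∂μ :=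
        lintegral_mono fun x => enorm_integral_rpow_le (by fun_prop) hp
    _ = eLpNorm k (ENNReal.ofReal p) ^ p := by
        rw [lintegral_lintegral_translate hk, eLpNorm_ofReal_rpow hp0]
    _ < ∞ := by exact ENNReal.rpow_lt_top_of_nonneg hp0.le hkp.eLpNorm_ne_top

/-- The centred sum `x ↦ ∑ⱼ (k(x - wⱼ) - E k(x - W))`. -/
noncomputable def centredSum (k : ℝ → ℂ) (μ : Measure ℝ) {n : ℕ} (w : Fin n → ℝ) (x : ℝ) : ℂ :=
  ∑ j, (k (x - w j) - meanKernel k μ x)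

theorem measurable_centredSum {k : ℝ → ℂ} (hk : Measurable k) (μ : Measure ℝ) [SFinite μ] (n : ℕ) :
    Measurable fun z : (Fin n → ℝ) × ℝ => centredSum k μ z.1 z.2 := by
  have := measurable_meanKernel hk μ
  unfold centredSum
  fun_prop

/-- The expected `L_p` norm of a centred sum of translates of `k` is at most of order `√n ‖k‖_p`. -/
theorem lintegral_eLpNorm_centredSum_le {p c : ℝ} (hp : 2 ≤ p) (hc1 : 1 ≤ c)
    (hc : ∀ a b : ℂ, ‖a + b‖ ^ p ≤ ‖a‖ ^ p + p * ‖a‖ ^ (p - 2) * inner ℝ a b +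
      c * (‖a‖ ^ (p - 2) * ‖b‖ ^ 2 + ‖b‖ ^ p))
    {k : ℝ → ℂ} (hk : Measurable k) {M : ℝ} (hM : ∀ x, ‖k x‖ ≤ M)
    (μ : Measure ℝ) [IsProbabilityMeasure μ] (n : ℕ) :
    ∫⁻ w : Fin n → ℝ, eLpNorm (centredSum k μ w) (ENNReal.ofReal p) ∂(Measure.pi fun _ => μ) ≤
      ENNReal.ofReal (2 * (2 * c * n) ^ (1 / 2 : ℝ)) * eLpNorm k (ENNReal.ofReal p) := by
  have hp0 : 0 < p := by linarith
  have hmean := measurable_meanKernel hk μ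
  have hS := measurable_centredSum hk μ n
  -- At fixed `x` the sum is scalar, so the moment inequality applies; the factor `2 ^ p` is the
  -- cost of removing the centring.
  have hpt : ∀ x, ∫⁻ w : Fin n → ℝ, ‖centredSum k μ w x‖ₑ ^ p ∂(Measure.pi fun _ => μ) ≤
      ENNReal.ofReal ((2 * c * n) ^ (p / 2)) * (2 ^ p * ∫⁻ w, ‖k (x - w)‖ₑ ^ p ∂μ) := by
    intro x
    set Y : ℝ → ℂ := fun w => k (x - w) - meanKernel k μ x with hY
    have mY : Measurable Y := by fun_prop
    have ik : Integrable (fun w => k (x - w)) μ :=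
      .of_bound (by exact (hk.comp (measurable_const.sub measurable_id)).aestronglyMeasurable) M (ae_of_all _ fun w => hM _)
    have hb : ∀ w, ‖Y w‖ ≤ M + M := fun w => by
      refine (norm_sub_le _ _).trans (add_le_add (hM _) ?_)
      refine (norm_integral_le_of_norm_le_const (ae_of_all _ fun w => hM (x - w))).trans ?_
      simp
    have h0 : ∫ w, Y w ∂μ = 0 := by
      rw [hY, integral_sub ik (integrable_const _)]
      simp [meanKernel]
    have hmain := integral_norm_sum_rpow_le hp hc1 hc mY hb h0 n
    have i1 : Integrable (fun w => ‖Y w‖ ^ p) μ := by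
      refine .of_bound (mY.norm.pow_const p).aestronglyMeasurable ((M + M) ^ p) (ae_of_all _ fun w => ?_)
      rw [Real.norm_of_nonneg (by positivity)]
      exact Real.rpow_le_rpow (norm_nonneg _) (hb w) hp0.le
    have i2 : Integrable (fun w : Fin n → ℝ => ‖∑ j, Y (w j)‖ ^ p) (Measure.pi fun _ => μ) := by
      have mYs : Measurable fun w : Fin n → ℝ => ∑ j, Y (w j) := by fun_prop
      refine .of_bound (mYs.norm.pow_const p).aestronglyMeasurable ((n * (M + M)) ^ p) (ae_of_all _ fun w => ?_)
      rw [Real.norm_of_nonneg (by positivity)]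
      refine Real.rpow_le_rpow (norm_nonneg _) ?_ hp0.le
      refine (norm_sum_le _ _).trans ((Finset.sum_le_sum fun j _ => hb (w j)).trans ?_)
      rw [Finset.sum_const, Finset.card_univ, Fintype.card_fin, nsmul_eq_mul]
    calc ∫⁻ w : Fin n → ℝ, ‖centredSum k μ w x‖ₑ ^ p ∂(Measure.pi fun _ => μ)
        = ENNReal.ofReal (∫ w : Fin n → ℝ, ‖∑ j, Y (w j)‖ ^ p ∂(Measure.pi fun _ => μ)) := by
          rw [ofReal_integral_eq_lintegral_ofReal i2 (ae_of_all _ fun w => by positivity)]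
          exact lintegral_congr fun w => enorm_rpow_eq_ofReal _ hp0.le
      _ ≤ ENNReal.ofReal ((2 * c * n) ^ (p / 2) * ∫ w, ‖Y w‖ ^ p ∂μ) :=
          by exact ENNReal.ofReal_le_ofReal hmain
      _ = ENNReal.ofReal ((2 * c * n) ^ (p / 2)) * ∫⁻ w, ‖Y w‖ₑ ^ p ∂μ := by
          rw [ENNReal.ofReal_mul (by positivity),
            ofReal_integral_eq_lintegral_ofReal i1 (ae_of_all _ fun w => by positivity)]
          congr 1
          exact lintegral_congr fun w => (enorm_rpow_eq_ofReal _ hp0.le).symm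
      _ ≤ _ := by
          gcongr
          exact lintegral_enorm_sub_integral_rpow_le (f := fun w => k (x - w)) (by fun_prop)
            (by linarith)
  rw [← ENNReal.rpow_le_rpow_iff hp0]
  have hms : Measurable fun z : (Fin n → ℝ) × ℝ => ‖centredSum k μ z.1 z.2‖ₑ ^ p :=
    hS.enorm.pow_const p
  have hme : Measurable fun w : Fin n → ℝ => eLpNorm (centredSum k μ w) (ENNReal.ofReal p) := by
    have h1 : (fun w : Fin n → ℝ => eLpNorm (centredSum k μ w) (ENNReal.ofReal p)) =
        fun w => (∫⁻ x, ‖centredSum k μ w x‖ₑ ^ p) ^ (1 / p) := by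
      ext w
      rw [eLpNorm_eq_lintegral_rpow_enorm_toReal (by simpa using hp0) ENNReal.ofReal_ne_top,
        ENNReal.toReal_ofReal hp0.le]
    rw [h1]
    exact hms.lintegral_prod_right'.pow_const _
  calc _ ≤ ∫⁻ w : Fin n → ℝ, eLpNorm (centredSum k μ w) (ENNReal.ofReal p) ^ p
          ∂(Measure.pi fun _ => μ) :=
        by exact lintegral_rpow_le_lintegral_rpow hme.aemeasurable (by linarith)
    _ = ∫⁻ w : Fin n → ℝ, (∫⁻ x, ‖centredSum k μ w x‖ₑ ^ p) ∂(Measure.pi fun _ => μ) := by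
        simp only [eLpNorm_ofReal_rpow hp0]
    _ = ∫⁻ x, ∫⁻ w : Fin n → ℝ, ‖centredSum k μ w x‖ₑ ^ p ∂(Measure.pi fun _ => μ) :=
        by
        exact lintegral_lintegral_swap (f := fun w x => ‖centredSum k μ w x‖ₑ ^ p) hms.aemeasurable
    _ ≤ ∫⁻ x, ENNReal.ofReal ((2 * c * n) ^ (p / 2)) *
          (2 ^ p * ∫⁻ w, ‖k (x - w)‖ₑ ^ p ∂μ) := by exact lintegral_mono hpt
    _ = ENNReal.ofReal ((2 * c * n) ^ (p / 2)) * (2 ^ p * ∫⁻ x, ‖k x‖ₑ ^ p) := by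
        rw [lintegral_const_mul' _ _ ENNReal.ofReal_ne_top,
          lintegral_const_mul' _ _ (by finiteness), lintegral_lintegral_translate hk]
    _ = _ := by
        have hx : 0 ≤ 2 * c * n := by positivity
        have h2 : (2 : ℝ≥0∞) ^ p = ENNReal.ofReal (2 ^ p) := by
          rw [← ENNReal.ofReal_rpow_of_pos (by norm_num), ENNReal.ofReal_ofNat]
        have h3 : (2 * (2 * c * n) ^ (1 / 2 : ℝ)) ^ p = (2 * c * n) ^ (p / 2) * 2 ^ p := by
          rw [Real.mul_rpow (by norm_num) (Real.rpow_nonneg hx _), ← Real.rpow_mul hx, mul_comm]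
          ring_nf
        rw [ENNReal.mul_rpow_of_nonneg _ _ hp0.le, eLpNorm_ofReal_rpow hp0, ← mul_assoc, h2,
          ENNReal.ofReal_rpow_of_nonneg (by positivity) hp0.le,
          ← ENNReal.ofReal_mul (Real.rpow_nonneg hx _), h3]

/-- Pairing a centred sum with a function of the unit ball of the dual space. -/
theorem enorm_sum_integral_mul_sub_le {p q : ℝ} (hpq : p.HolderConjugate q)
    {k : ℝ → ℂ} (hk : Measurable k) (hkp : MemLp k (ENNReal.ofReal p))
    (μ : Measure ℝ) [IsProbabilityMeasure μ] {n : ℕ} (w : Fin n → ℝ)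
    {m : ℝ → ℝ} (hm : MemLp m (ENNReal.ofReal q)) (hm1 : eLpNorm m (ENNReal.ofReal q) ≤ 1) :
    ‖∑ j, ((∫ x, k (x - w j) * (m x : ℂ)) - ∫ x, meanKernel k μ x * (m x : ℂ))‖ₑ ≤
      eLpNorm (centredSum k μ w) (ENNReal.ofReal p) := by
  have hmC : MemLp (fun x => (m x : ℂ)) (ENNReal.ofReal q) := hm.ofReal
  have : ENNReal.HolderConjugate (ENNReal.ofReal p) (ENNReal.ofReal q) := hpq.ennrealOfReal
  have hmean := memLp_meanKernel hk μ hpq.lt.le hkp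
  have htr : ∀ z : ℝ, MemLp (fun x => k (x - z)) (ENNReal.ofReal p) := fun z =>
    hkp.comp_measurePreserving (measurePreserving_sub_right volume z)
  have i1 : ∀ z, Integrable (fun x => k (x - z) * (m x : ℂ)) := fun z =>
    (htr z).integrable_mul hmC
  have i2 : Integrable (fun x => meanKernel k μ x * (m x : ℂ)) := hmean.integrable_mul hmC
  have i3 : ∀ j, Integrable (fun x => k (x - w j) * (m x : ℂ) - meanKernel k μ x * (m x : ℂ)) :=
    fun j => (i1 _).sub i2
  -- The sum of pairings is one pairing with the centred sum, to which Hölder applies uniformly in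
  -- `m`.
  have e : ∑ j, ((∫ x, k (x - w j) * (m x : ℂ)) - ∫ x, meanKernel k μ x * (m x : ℂ)) =
      ∫ x, centredSum k μ w x * (m x : ℂ) := by
    simp only [centredSum, Finset.sum_mul, sub_mul]
    rw [integral_finsetSum _ fun j _ => i3 j]
    exact Finset.sum_congr rfl fun j _ => (integral_sub (i1 _) i2).symm
  have hSm : AEStronglyMeasurable (centredSum k μ w) :=
    ((measurable_centredSum hk μ n).comp measurable_prodMk_left).aestronglyMeasurable
  rw [e]
  calc _ ≤ ∫⁻ x, ‖centredSum k μ w x * (m x : ℂ)‖ₑ := by exact enorm_integral_le_lintegral_enorm _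
    _ = eLpNorm (centredSum k μ w • fun x => (m x : ℂ)) 1 := by
        rw [eLpNorm_one_eq_lintegral_enorm]; rfl
    _ ≤ eLpNorm (centredSum k μ w) (ENNReal.ofReal p) *
          eLpNorm (fun x => (m x : ℂ)) (ENNReal.ofReal q) :=
        by exact eLpNorm_smul_le_mul_eLpNorm hmC.1 hSm
    _ ≤ eLpNorm (centredSum k μ w) (ENNReal.ofReal p) * 1 := by
        gcongr
        refine le_trans (le_of_eq ?_) hm1
        exact eLpNorm_congr_norm_ae (ae_of_all _ fun x => by simp)
    _ = _ := by exact mul_one _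

/-! ### Inverse transforms of band-limited multipliers -/

/-- The inverse Fourier transform `z ↦ (2π)⁻¹ ∫ e^{-itz} G(t) dt`. -/
noncomputable def invFT (G : ℝ → ℂ) (z : ℝ) : ℂ :=
  (1 / (2 * Real.pi : ℂ)) * ∫ t : ℝ, Complex.exp (-(Complex.I * t * z)) * G t

theorem norm_exp_neg_I_mul (t z : ℝ) : ‖Complex.exp (-(Complex.I * t * z))‖ = 1 := by
  have : -(Complex.I * t * z) = ((-(t * z) : ℝ) : ℂ) * Complex.I := by push_cast; ring
  rw [this, Complex.norm_exp_ofReal_mul_I]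

theorem norm_exp_I_mul (t z : ℝ) : ‖Complex.exp (Complex.I * t * z)‖ = 1 := by
  have : Complex.I * t * z = ((t * z : ℝ) : ℂ) * Complex.I := by push_cast; ring
  rw [this, Complex.norm_exp_ofReal_mul_I]

theorem invFT_eq_fourier (G : ℝ → ℂ) (z : ℝ) :
    invFT G z = (1 / (2 * Real.pi : ℂ)) *
      (FourierTransform.fourier G : ℝ → ℂ) ((2 * Real.pi)⁻¹ * z) := by
  rw [invFT, Real.fourier_real_eq_integral_exp_smul]
  congr 1
  refine integral_congr_ae (ae_of_all _ fun t => ?_)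
  simp only [smul_eq_mul]
  congr 2
  have : (Real.pi : ℂ) ≠ 0 := by exact_mod_cast Real.pi_ne_zero
  push_cast
  field_simp

theorem continuous_invFT {G : ℝ → ℂ} (hG : Integrable G) : Continuous (invFT G) := by
  have : invFT G = fun z => (1 / (2 * Real.pi : ℂ)) *
      (FourierTransform.fourier G : ℝ → ℂ) ((2 * Real.pi)⁻¹ * z) := funext (invFT_eq_fourier G)
  rw [this]
  exact continuous_const.mul ((continuous_fourier_of_integrable hG).comp (continuous_const_mul _))

theorem lintegral_comp_mul_left {a : ℝ} (ha : 0 < a) {f : ℝ → ℝ≥0∞} (hf : Measurable f) :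
    ∫⁻ x, f (a * x) = ENNReal.ofReal a⁻¹ * ∫⁻ x, f x := by
  rw [← lintegral_map hf (measurable_const_mul a), Real.map_volume_mul_left ha.ne',
    lintegral_smul_measure, abs_of_pos (inv_pos.2 ha), smul_eq_mul]

/-- Plancherel in the convention without `2π` in the exponent: the prefactor contributes (2π)⁻² and
the dilation of the argument 2π. -/
theorem lintegral_enorm_invFT_sq {G : ℝ → ℂ} (h1 : Integrable G) (h2 : MemLp G 2) :
    ∫⁻ z, ‖invFT G z‖ₑ ^ (2 : ℝ) = ENNReal.ofReal (2 * Real.pi)⁻¹ * ∫⁻ t, ‖G t‖ₑ ^ (2 : ℝ) := by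
  have hpi : 0 < 2 * Real.pi := by positivity
  have e : ∀ g : ℝ → ℂ, eLpNorm g 2 ^ (2 : ℝ) = ∫⁻ x, ‖g x‖ₑ ^ (2 : ℝ) := fun g => by
    simpa using eLpNorm_ofReal_rpow (μ := volume) (p := 2) (by norm_num) g
  have hpl : ∫⁻ x, ‖(FourierTransform.fourier G : ℝ → ℂ) x‖ₑ ^ (2 : ℝ) =
      ∫⁻ t, ‖G t‖ₑ ^ (2 : ℝ) := by
    rw [← e, ← e, eLpNorm_fourier_two h1 h2]
  have hc : ‖(1 / (2 * Real.pi : ℂ))‖ₑ = ENNReal.ofReal (2 * Real.pi)⁻¹ := by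
    rw [← ofReal_norm]
    congr 1
    rw [one_div, norm_inv, ← Complex.ofReal_ofNat, ← Complex.ofReal_mul, Complex.norm_real,
      Real.norm_of_nonneg hpi.le]
  simp_rw [invFT_eq_fourier, enorm_mul, ENNReal.mul_rpow_of_nonneg _ _ zero_le_two, hc]
  rw [lintegral_const_mul' _ _ (by finiteness),
    lintegral_comp_mul_left (inv_pos.2 hpi)
      (f := fun x => ‖(FourierTransform.fourier G : ℝ → ℂ) x‖ₑ ^ (2 : ℝ))
      ((continuous_fourier_of_integrable h1).measurable.enorm.pow_const _), hpl, ← mul_assoc,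
    ENNReal.ofReal_rpow_of_pos (inv_pos.2 hpi), ← ENNReal.ofReal_mul (by positivity)]
  congr 2
  rw [inv_inv, Real.rpow_two]
  field_simp

/-- A continuous function supported in `[-R, R]` and bounded by `A`. -/
structure IsBandLimitedMultiplier (G : ℝ → ℂ) (R A : ℝ) : Prop where
  continuous : Continuous G
  radius_nonneg : 0 ≤ R
  norm_le : ∀ t, ‖G t‖ ≤ A
  eq_zero : ∀ t, R < |t| → G t = 0

namespace IsBandLimitedMultiplier

variable {G : ℝ → ℂ} {R A : ℝ}

theorem bound_nonneg (hG : IsBandLimitedMultiplier G R A) : 0 ≤ A :=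
  (norm_nonneg _).trans (hG.norm_le 0)

theorem hasCompactSupport (hG : IsBandLimitedMultiplier G R A) : HasCompactSupport G := by
  refine HasCompactSupport.intro (isCompact_Icc (a := -R) (b := R)) fun t ht => hG.eq_zero t ?_
  rw [Set.mem_Icc, ← abs_le] at ht
  exact not_le.1 ht

theorem integrable (hG : IsBandLimitedMultiplier G R A) : Integrable G :=
  hG.continuous.integrable_of_hasCompactSupport hG.hasCompactSupport

theorem memLp_two (hG : IsBandLimitedMultiplier G R A) : MemLp G 2 :=
  hG.continuous.memLp_of_hasCompactSupport hG.hasCompactSupport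

theorem lintegral_enorm_rpow_le (hG : IsBandLimitedMultiplier G R A) {r : ℝ} (hr : 0 < r) :
    ∫⁻ t, ‖G t‖ₑ ^ r ≤ ENNReal.ofReal (A ^ r * (2 * R)) := by
  have hA := hG.bound_nonneg
  calc ∫⁻ t, ‖G t‖ₑ ^ r
      ≤ ∫⁻ t, (Set.Icc (-R) R).indicator (fun _ => ENNReal.ofReal (A ^ r)) t := by
        refine lintegral_mono fun t => ?_
        by_cases ht : t ∈ Set.Icc (-R) R
        · rw [Set.indicator_of_mem ht, enorm_rpow_eq_ofReal _ hr.le]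
          exact ENNReal.ofReal_le_ofReal
            (Real.rpow_le_rpow (norm_nonneg _) (hG.norm_le t) hr.le)
        · rw [Set.indicator_of_notMem ht, hG.eq_zero t, enorm_zero, ENNReal.zero_rpow_of_pos hr]
          rw [Set.mem_Icc, ← abs_le] at ht
          exact not_le.1 ht
    _ = ENNReal.ofReal (A ^ r) * ENNReal.ofReal (2 * R) := by
        rw [lintegral_indicator measurableSet_Icc, setLIntegral_const, Real.volume_Icc]
        congr 2
        ring
    _ = _ := by rw [← ENNReal.ofReal_mul (by positivity)]

theorem integral_norm_le (hG : IsBandLimitedMultiplier G R A) : ∫ t, ‖G t‖ ≤ A * (2 * R) := by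
  have hA := hG.bound_nonneg
  have hR := hG.radius_nonneg
  rw [integral_norm_eq_lintegral_enorm hG.integrable.1]
  have := hG.lintegral_enorm_rpow_le one_pos
  simp only [ENNReal.rpow_one, Real.rpow_one] at this
  exact ENNReal.toReal_le_of_le_ofReal (by positivity) this

theorem norm_invFT_le (hG : IsBandLimitedMultiplier G R A) (z : ℝ) : ‖invFT G z‖ ≤ A * R := by
  have hA := hG.bound_nonneg
  have hR := hG.radius_nonneg
  have h1 : ‖∫ t : ℝ, Complex.exp (-(Complex.I * t * z)) * G t‖ ≤ A * (2 * R) := by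
    refine (norm_integral_le_integral_norm _).trans (le_trans (le_of_eq ?_) hG.integral_norm_le)
    simp_rw [norm_mul, norm_exp_neg_I_mul, one_mul]
  have h2 : ‖(1 / (2 * Real.pi : ℂ))‖ = (2 * Real.pi)⁻¹ := by
    rw [one_div, norm_inv, ← Complex.ofReal_ofNat, ← Complex.ofReal_mul, Complex.norm_real,
      Real.norm_of_nonneg (by positivity)]
  rw [invFT, norm_mul, h2, inv_mul_le_iff₀ (by positivity)]
  refine h1.trans ?_
  nlinarith [Real.pi_gt_three, mul_nonneg hA hR]

/-- Interpolation between the supremum norm and the `L_2` norm. -/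
theorem eLpNorm_invFT_le (hG : IsBandLimitedMultiplier G R A) (hR : 0 < R) {p : ℝ} (hp : 2 ≤ p) :
    eLpNorm (invFT G) (ENNReal.ofReal p) ≤ ENNReal.ofReal (A * R ^ (1 - 1 / p)) := by
  have hA := hG.bound_nonneg
  have hp0 : 0 < p := by linarith
  -- `p - 2` powers are bounded by the sup norm and the remaining two integrated by Plancherel; this
  -- uses p ≥ 2.
  have hsplit : ∀ x : ℝ≥0∞, x ^ p = x ^ (p - 2) * x ^ (2 : ℝ) := fun x => by
    rw [← ENNReal.rpow_add_of_nonneg _ _ (by linarith) zero_le_two]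
    congr 1; ring
  rw [← ENNReal.rpow_le_rpow_iff hp0, eLpNorm_ofReal_rpow hp0]
  calc ∫⁻ z, ‖invFT G z‖ₑ ^ p
      ≤ ∫⁻ z, ENNReal.ofReal ((A * R) ^ (p - 2)) * ‖invFT G z‖ₑ ^ (2 : ℝ) := by
        refine lintegral_mono fun z => ?_
        simp only
        rw [hsplit, enorm_rpow_eq_ofReal _ (by linarith : 0 ≤ p - 2)]
        gcongr
        exact hG.norm_invFT_le z
    _ = ENNReal.ofReal ((A * R) ^ (p - 2)) *
          (ENNReal.ofReal (2 * Real.pi)⁻¹ * ∫⁻ t, ‖G t‖ₑ ^ (2 : ℝ)) := by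
        rw [lintegral_const_mul' _ _ ENNReal.ofReal_ne_top,
          lintegral_enorm_invFT_sq hG.integrable hG.memLp_two]
    _ ≤ ENNReal.ofReal ((A * R) ^ (p - 2)) *
          (ENNReal.ofReal (2 * Real.pi)⁻¹ * ENNReal.ofReal (A ^ (2 : ℝ) * (2 * R))) := by
        gcongr
        exact hG.lintegral_enorm_rpow_le two_pos
    _ = ENNReal.ofReal ((A * R) ^ (p - 2) * ((2 * Real.pi)⁻¹ * (A ^ (2 : ℝ) * (2 * R)))) := by
        rw [← ENNReal.ofReal_mul (by positivity), ← ENNReal.ofReal_mul (by positivity)]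
    _ ≤ ENNReal.ofReal ((A * R ^ (1 - 1 / p)) ^ p) := by
        apply ENNReal.ofReal_le_ofReal
        have e1 : (A * R ^ (1 - 1 / p)) ^ p = (A * R) ^ (p - 2) * (A ^ (2 : ℝ) * R) := by
          rw [Real.mul_rpow hA (by positivity), ← Real.rpow_mul hR.le, Real.mul_rpow hA hR.le]
          have h1 : A ^ p = A ^ (p - 2) * A ^ (2 : ℝ) := by
            rw [← Real.rpow_add_of_nonneg hA (by linarith) zero_le_two]; congr 1; ring
          have h2 : R ^ ((1 - 1 / p) * p) = R ^ (p - 2) * R := by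
            rw [← Real.rpow_add_one hR.ne']; congr 1; field_simp; ring
          rw [h1, h2]; ring
        rw [e1]
        refine mul_le_mul_of_nonneg_left ?_ (by positivity)
        rw [inv_mul_le_iff₀ (by positivity)]
        have : 0 ≤ A ^ (2 : ℝ) * R := by positivity
        nlinarith [Real.pi_gt_three]
    _ = _ := by rw [ENNReal.ofReal_rpow_of_nonneg (by positivity) hp0.le]

end IsBandLimitedMultiplier

/-! ### Characteristic functions and the supersmooth lower bound -/

theorem IsProbDensity.integrable {f : ℝ → ℝ} (hf : IsProbDensity f) : Integrable f := by
  by_contra h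
  have := hf.integral_eq_one
  rw [integral_undef h] at this
  exact zero_ne_one this

theorem norm_ft_le (f : ℝ → ℝ) (t : ℝ) : ‖ft f t‖ ≤ ∫ x, ‖f x‖ := by
  refine (norm_integral_le_integral_norm _).trans (le_of_eq ?_)
  simp_rw [norm_mul, norm_exp_I_mul, one_mul, Complex.norm_real]

theorem continuous_ft {f : ℝ → ℝ} (hf : Integrable f) : Continuous (ft f) := by
  refine continuous_of_dominated (bound := fun x => ‖f x‖) (fun t => ?_) (fun t => ?_) hf.norm ?_
  · exact (Continuous.aestronglyMeasurable (by fun_prop)).mul hf.ofReal.aestronglyMeasurable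
  · refine ae_of_all _ fun x => ?_
    rw [norm_mul, norm_exp_I_mul, one_mul, Complex.norm_real]
  · exact ae_of_all _ fun x => by fun_prop

theorem ft_neg (f : ℝ → ℝ) (t : ℝ) : ft f (-t) = (starRingEnd ℂ) (ft f t) := by
  rw [ft, ft, ← integral_conj]
  refine integral_congr_ae (ae_of_all _ fun x => ?_)
  simp only [map_mul, ← Complex.exp_conj, Complex.conj_I, Complex.conj_ofReal]
  push_cast
  ring_nf

/-- Supersmoothness is assumed only as `t → +∞`; conjugate symmetry of the transform of a real
function carries it to negative `t`. -/
theorem norm_ft_abs (f : ℝ → ℝ) (t : ℝ) : ‖ft f |t|‖ = ‖ft f t‖ := by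
  rcases abs_choice t with h | h <;> rw [h]
  rw [ft_neg, RCLike.norm_conj]

/-- The growth rate of `sup_{|t| ≤ 1/h} |φ(t)|⁻¹` for a supersmooth density. -/
noncomputable def inverseRate (β β₀ ϱ h : ℝ) : ℝ :=
  (if 0 ≤ β₀ then 1 else h ^ β₀) * Real.exp (h ^ (-β) / ϱ)

theorem exists_inv_norm_ft_le {β β₀ ϱ : ℝ} {ψ : ℝ → ℝ} (hψ : IsProbDensity ψ)
    (hss : IsSupersmooth ψ β β₀ ϱ) (hne : ∀ t : ℝ, ft ψ t ≠ 0) (H : ℝ) :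
    ∃ C : ℝ, 0 < C ∧ ∀ h t : ℝ, 0 < h → h ≤ H → |t| ≤ 1 / h →
      ‖ft ψ t‖⁻¹ ≤ C * inverseRate β β₀ ϱ h := by
  obtain ⟨hβ, hϱ, β₁, d₀, d₁, hd₀, -, hev⟩ := hss
  obtain ⟨T, hT⟩ := eventually_atTop.1 hev
  -- With |t| > 1 beyond the threshold, |t|^(-β₀) ≤ 1 when β₀ ≥ 0.
  set T' := max T 1
  have hcont : Continuous fun t => ‖ft ψ t‖⁻¹ :=
    (continuous_ft hψ.integrable).norm.inv₀ fun t => norm_ne_zero_iff.2 (hne t)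
  obtain ⟨M, hM⟩ := (isCompact_Icc (a := -T') (b := T')).exists_bound_of_continuousOn
    hcont.continuousOn
  set H' := max H 1
  have hH' : 0 < H' := lt_of_lt_of_le one_pos (le_max_right _ _)
  have hM0 : 0 ≤ M := (norm_nonneg _).trans (hM 0 (by
    have : (1 : ℝ) ≤ T' := le_max_right _ _
    constructor <;> linarith))
  -- A lower bound for the rate over all 0 < h ≤ H, needed to absorb the bound `M` on the compact
  -- range of `t`. For β₀ < 0 the upper bound `H` on the bandwidth is what makes it positive.
  set b : ℝ := if 0 ≤ β₀ then 1 else H' ^ β₀ with hb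
  have hb0 : 0 < b := by
    rw [hb]; split_ifs <;> positivity
  refine ⟨M / b + d₀⁻¹, by positivity, fun h t hh hhH ht => ?_⟩
  have hr0 : 0 < (if 0 ≤ β₀ then 1 else h ^ β₀ : ℝ) := by
    split_ifs <;> positivity
  have hbr : b ≤ (if 0 ≤ β₀ then 1 else h ^ β₀ : ℝ) := by
    rw [hb]
    split_ifs with h0
    · exact le_rfl
    · exact Real.rpow_le_rpow_of_nonpos hh (hhH.trans (le_max_left _ _)) (not_le.1 h0).le
  have hexp : 1 ≤ Real.exp (h ^ (-β) / ϱ) := Real.one_le_exp (by positivity)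
  have hrate : b ≤ inverseRate β β₀ ϱ h :=
    hbr.trans (le_mul_of_one_le_right hr0.le hexp)
  have hrate0 : 0 < inverseRate β β₀ ϱ h := hb0.trans_le hrate
  rcases le_or_gt |t| T' with h1 | h1
  · have h2 : ‖ft ψ t‖⁻¹ ≤ M := (le_abs_self _).trans (hM t (abs_le.1 h1))
    have h3 : M ≤ M / b * inverseRate β β₀ ϱ h := by
      rw [div_mul_eq_mul_div, le_div_iff₀ hb0]
      gcongr
    have h4 : 0 ≤ d₀⁻¹ * inverseRate β β₀ ϱ h := by positivity
    linarith
  · have ht1 : 1 < |t| := (le_max_right _ _).trans_lt h1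
    have ht0 : 0 < |t| := by linarith
    have h2 := (hT |t| ((le_max_left _ _).trans h1.le)).1
    rw [abs_abs, norm_ft_abs] at h2
    have h3 : ‖ft ψ t‖⁻¹ ≤ d₀⁻¹ * (|t| ^ (-β₀) * Real.exp (|t| ^ β / ϱ)) := by
      refine (inv_anti₀ (by positivity) h2).trans (le_of_eq ?_)
      rw [mul_inv, mul_inv, Real.exp_neg, inv_inv, Real.rpow_neg ht0.le, mul_assoc]
    have h4 : |t| ^ (-β₀) ≤ (if 0 ≤ β₀ then 1 else h ^ β₀ : ℝ) := by
      split_ifs with h0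
      · exact Real.rpow_le_one_of_one_le_of_nonpos ht1.le (by linarith)
      · refine (Real.rpow_le_rpow ht0.le ht (by linarith)).trans (le_of_eq ?_)
        rw [one_div, Real.inv_rpow hh.le, Real.rpow_neg hh.le, inv_inv]
    have h5 : |t| ^ β ≤ h ^ (-β) := by
      refine (Real.rpow_le_rpow ht0.le ht hβ.le).trans (le_of_eq ?_)
      rw [one_div, Real.inv_rpow hh.le, Real.rpow_neg hh.le]
    have h6 : ‖ft ψ t‖⁻¹ ≤ d₀⁻¹ * inverseRate β β₀ ϱ h := by
      refine h3.trans ?_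
      rw [inverseRate]
      gcongr
    have h7 : 0 ≤ M / b * inverseRate β β₀ ϱ h := by positivity
    linarith

/-! ### The deconvolution estimator as a sum of translated kernels -/

/-- The Fourier multiplier `t ↦ φ_K(h t) / φ_ψ(t)` of the deconvoluting kernel. -/
noncomputable def deconvMultiplier (ψ K : ℝ → ℝ) (h t : ℝ) : ℂ := ft K (h * t) / ft ψ t

theorem isBandLimitedMultiplier_deconvMultiplier {ψ K : ℝ → ℝ} (hψ : Integrable ψ)
    (hne : ∀ t : ℝ, ft ψ t ≠ 0) (hK : IsBandLimitedKernel K) {h B : ℝ} (hh : 0 < h)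
    (hB : ∀ t, |t| ≤ 1 / h → ‖ft ψ t‖⁻¹ ≤ B) :
    IsBandLimitedMultiplier (deconvMultiplier ψ K h) (1 / h) ((∫ x, ‖K x‖) * B) := by
  have hz : ∀ t, 1 / h < |t| → deconvMultiplier ψ K h t = 0 := fun t ht => by
    rw [deconvMultiplier, hK.ft_eq_zero, zero_div]
    rwa [abs_mul, abs_of_pos hh, mul_comm, ← div_lt_iff₀ hh]
  have hK0 : 0 ≤ ∫ x, ‖K x‖ := integral_nonneg fun x => norm_nonneg _
  have hB0 : 0 ≤ B := (inv_nonneg.2 (norm_nonneg _)).trans (hB 0 (by simp [hh.le]))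
  refine ⟨?_, by positivity, fun t => ?_, hz⟩
  · exact ((continuous_ft hK.integrable).comp (continuous_const_mul h)).div (continuous_ft hψ) hne
  · rcases le_or_gt |t| (1 / h) with ht | ht
    · rw [deconvMultiplier, norm_div, div_eq_mul_inv]
      exact mul_le_mul (norm_ft_le K _) (hB t ht) (by positivity) hK0
    · rw [hz t ht, norm_zero]
      positivity

/-- The change of variables t ↦ ht moves the bandwidth from the argument of φ_ψ to that of φ_K. -/
theorem scaledKernel_eq_invFT (ψ K : ℝ → ℝ) {h : ℝ} (hh : 0 < h) :
    scaledKernel ψ K h = invFT (deconvMultiplier ψ K h) := by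
  ext z
  have hC : (h : ℂ) ≠ 0 := by exact_mod_cast hh.ne'
  have := Measure.integral_comp_mul_left
    (fun t : ℝ => Complex.exp (-(Complex.I * t * (z / h : ℝ))) * (ft K t / ft ψ (t / h))) h
  rw [scaledKernel, deconvKernel, invFT, mul_left_comm]
  congr 1
  rw [abs_of_pos (inv_pos.2 hh), Complex.real_smul] at this
  rw [one_div, ← Complex.ofReal_inv, ← this]
  refine integral_congr_ae (ae_of_all _ fun t => ?_)
  simp only [deconvMultiplier]
  rw [mul_div_cancel_left₀ _ hh.ne']
  congr 3
  push_cast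
  field_simp

theorem estimator_eq {ψ K : ℝ → ℝ} {h : ℝ} (hh : 0 < h)
    (hG : Integrable (deconvMultiplier ψ K h)) {n : ℕ} (w : Fin n → ℝ) (x : ℝ) :
    estimator ψ K h w x = (1 / (n : ℂ)) * ∑ j, scaledKernel ψ K h (x - w j) := by
  have hi : ∀ z : ℝ, Integrable fun t : ℝ =>
      Complex.exp (-(Complex.I * t * z)) * deconvMultiplier ψ K h t := fun z => by
    refine hG.bdd_mul (c := 1) (Continuous.aestronglyMeasurable (by fun_prop))
      (ae_of_all _ fun t => (norm_exp_neg_I_mul t z).le)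
  simp_rw [scaledKernel_eq_invFT ψ K hh, invFT, ← Finset.mul_sum]
  rw [mul_left_comm, ← integral_finsetSum _ fun j _ => hi _, ← integral_const_mul, estimator]
  congr 1
  refine integral_congr_ae (ae_of_all _ fun t => ?_)
  simp only [empiricalCF, deconvMultiplier]
  rw [mul_left_comm, mul_assoc, Finset.mul_sum, Finset.sum_mul]
  congr 1
  refine Finset.sum_congr rfl fun j _ => ?_
  rw [← Complex.exp_add]
  congr 2
  push_cast
  ring

theorem isProbabilityMeasure_obsLaw {fX ψ : ℝ → ℝ} (hf : IsProbDensity fX)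
    (hψ : IsProbDensity ψ) : IsProbabilityMeasure (obsLaw fX ψ) := by
  have hi : Integrable (obsDensity fX ψ) :=
    hf.integrable.integrable_convolution (ContinuousLinearMap.mul ℝ ℝ) hψ.integrable
  have h0 : ∀ x, 0 ≤ obsDensity fX ψ x := fun x =>
    integral_nonneg fun y => mul_nonneg (hf.nonneg _) (hψ.nonneg _)
  have h1 : ∫ x, obsDensity fX ψ x = 1 := by
    have := integral_convolution (ContinuousLinearMap.mul ℝ ℝ) hf.integrable hψ.integrable
    rw [hf.integral_eq_one, hψ.integral_eq_one] at this
    simpa [obsDensity] using this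
  refine ⟨?_⟩
  rw [obsLaw, withDensity_apply _ MeasurableSet.univ, Measure.restrict_univ,
    ← ofReal_integral_eq_lintegral_ofReal hi (ae_of_all _ h0), h1, ENNReal.ofReal_one]

theorem meanEstimator_eq {fX ψ K : ℝ → ℝ} (hf : IsProbDensity fX) (hψ : IsProbDensity ψ)
    {h : ℝ} (hh : 0 < h) (hG : Integrable (deconvMultiplier ψ K h)) {M : ℝ}
    (hM : ∀ z, ‖scaledKernel ψ K h z‖ ≤ M) (n : ℕ) (x : ℝ) :
    meanEstimator fX ψ K h n x =
      (1 / (n : ℂ)) * ∑ _j : Fin n, meanKernel (scaledKernel ψ K h) (obsLaw fX ψ) x := by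
  have := isProbabilityMeasure_obsLaw hf hψ
  have hc : Continuous (scaledKernel ψ K h) := by
    rw [scaledKernel_eq_invFT ψ K hh]; exact continuous_invFT hG
  have hc' : Continuous fun w => scaledKernel ψ K h (x - w) := hc.comp (by fun_prop)
  rw [meanEstimator]
  simp_rw [estimator_eq hh hG]
  rw [integral_const_mul, sampleLaw, integral_finsetSum]
  · congr 1
    refine Finset.sum_congr rfl fun j _ => ?_
    exact integral_comp_eval (μ := fun _ : Fin n => obsLaw fX ψ) (i := j)
      (f := fun w => scaledKernel ψ K h (x - w)) hc'.aestronglyMeasurable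
  · intro j _
    exact .of_bound (hc'.comp (continuous_apply j)).aestronglyMeasurable M
      (ae_of_all _ fun w => hM _)

theorem expectedDeviation_eq {fX ψ K : ℝ → ℝ} (hf : IsProbDensity fX) (hψ : IsProbDensity ψ)
    {h : ℝ} (hh : 0 < h) (hG : Integrable (deconvMultiplier ψ K h)) {M : ℝ}
    (hM : ∀ z, ‖scaledKernel ψ K h z‖ ≤ M) (p : ℝ) {n : ℕ} (hn : 1 ≤ n) :
    (n : ℝ≥0∞) * expectedDeviation fX ψ K h p n =
      ∫⁻ w : Fin n → ℝ, eLpNorm (centredSum (scaledKernel ψ K h) (obsLaw fX ψ) w)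
        (ENNReal.ofReal p) ∂(Measure.pi fun _ => obsLaw fX ψ) := by
  have hn0 : (n : ℝ≥0∞) ≠ 0 := by
    rw [Nat.cast_ne_zero]; omega
  have e : ∀ w : Fin n → ℝ,
      (fun x => estimator ψ K h w x - meanEstimator fX ψ K h n x) =
        (1 / (n : ℂ)) • centredSum (scaledKernel ψ K h) (obsLaw fX ψ) w := fun w => by
    ext x
    rw [estimator_eq hh hG, meanEstimator_eq hf hψ hh hG hM, ← mul_sub, ← Finset.sum_sub_distrib]
    rfl
  have hnorm : ‖1 / (n : ℂ)‖ₑ = (n : ℝ≥0∞)⁻¹ := by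
    rw [one_div, enorm_inv (by rw [Nat.cast_ne_zero]; omega)]
    congr 1
    rw [← ofReal_norm, Complex.norm_natCast, ENNReal.ofReal_natCast]
  rw [expectedDeviation, sampleLaw, ← lintegral_const_mul' _ _ (ENNReal.natCast_ne_top n)]
  refine lintegral_congr fun w => ?_
  rw [e, eLpNorm_const_smul, hnorm, ← mul_assoc,
    ENNReal.mul_inv_cancel hn0 (ENNReal.natCast_ne_top n), one_mul]

theorem expectedSup_le {fX ψ K : ℝ → ℝ} (hf : IsProbDensity fX) (hψ : IsProbDensity ψ)
    {h p q : ℝ} (hpq : p.HolderConjugate q) (hk : Measurable (scaledKernel ψ K h))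
    (hkp : MemLp (scaledKernel ψ K h) (ENNReal.ofReal p)) (n : ℕ)
    {B : Set (Lp ℝ (ENNReal.ofReal q) (volume : Measure ℝ))} (hB : ∀ m ∈ B, ‖m‖ ≤ 1) :
    expectedSup fX ψ n (kernelClass fX ψ K h q B) ≤
      ∫⁻ w : Fin n → ℝ, eLpNorm (centredSum (scaledKernel ψ K h) (obsLaw fX ψ) w)
        (ENNReal.ofReal p) ∂(Measure.pi fun _ => obsLaw fX ψ) := by
  have := isProbabilityMeasure_obsLaw hf hψ
  refine lintegral_mono fun w => iSup₂_le ?_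
  rintro _ ⟨m, hm, rfl⟩
  refine enorm_sum_integral_mul_sub_le hpq hk hkp _ w (Lp.memLp m) ?_
  rw [← ENNReal.ofReal_toReal (Lp.eLpNorm_ne_top m), ← Lp.norm_def]
  exact ENNReal.ofReal_le_one.2 (hB m hm)

end DKE

/-! ### Assembly of the bounds -/

theorem lemma3
    (β β₀ ϱ : ℝ) (ψσ : ℝ → ℝ) (hψ : DKE.IsProbDensity ψσ)
    (hss : DKE.IsSupersmooth ψσ β β₀ ϱ) (hne : ∀ t : ℝ, DKE.ft ψσ t ≠ 0)
    (K : ℝ → ℝ) (hK : DKE.IsBandLimitedKernel K)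
    (p q : ℝ) (hp : 2 ≤ p) (hpq : 1 / p + 1 / q = 1)
    (H : ℝ) :
    ∃ C : ℝ, 0 < C ∧
      ∀ h : ℕ → ℝ, (∀ n, 1 ≤ n → 0 < h n ∧ h n ≤ H) → Tendsto h atTop (𝓝 0) →
      ∀ fX : ℝ → ℝ, DKE.IsProbDensity fX →
      ∀ n : ℕ, 1 ≤ n →
        (n : ℝ≥0∞) * DKE.expectedDeviation fX ψσ K (h n) p n ≤
            ENNReal.ofReal (C * ((n : ℝ) ^ (1 / 2 : ℝ) * h n ^ DKE.varpi p β₀ *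
              Real.exp (h n ^ (-β) / ϱ))) ∧
        ∀ B : Set (Lp ℝ (ENNReal.ofReal q) (volume : Measure ℝ)), DKE.IsCountableNorming p q B →
          DKE.expectedSup fX ψσ n (DKE.kernelClass fX ψσ K (h n) q B) ≤
            ENNReal.ofReal (C * ((n : ℝ) ^ (1 / 2 : ℝ) * h n ^ DKE.varpi p β₀ *
              Real.exp (h n ^ (-β) / ϱ))) := by
  obtain ⟨c, hc1, hc⟩ := DKE.exists_norm_add_rpow_le (E := ℂ) hp
  obtain ⟨C, hC, hinv⟩ := DKE.exists_inv_norm_ft_le hψ hss hne H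
  have hp0 : 0 < p := by linarith
  have hconj : p.HolderConjugate q :=
    Real.holderConjugate_iff.2 ⟨by linarith, by simpa only [one_div] using hpq⟩
  -- φ_K(0) = 1 forces the `L¹` norm of `K` to be at least 1, hence the final constant to be
  -- positive.
  have hκ : 1 ≤ ∫ x, ‖K x‖ := by
    simpa [hK.ft_zero] using DKE.norm_ft_le K 0
  have hκ0 : 0 < ∫ x, ‖K x‖ := by linarith
  -- The first factor comes from the moment bound with √n removed, the second from the sup bound on
  -- the multiplier; neither involves `h`, `fX` or `n`.
  refine ⟨2 * (2 * c) ^ (1 / 2 : ℝ) * ((∫ x, ‖K x‖) * C), by positivity,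
    fun h hh _ fX hf n hn => ?_⟩
  obtain ⟨hn0, hnH⟩ := hh n hn
  have := DKE.isProbabilityMeasure_obsLaw hf hψ
  have hG := DKE.isBandLimitedMultiplier_deconvMultiplier hψ.integrable hne hK hn0
    fun t ht => hinv (h n) t hn0 hnH ht
  have hk := DKE.scaledKernel_eq_invFT ψσ K hn0
  have hkm : Measurable (DKE.scaledKernel ψσ K (h n)) := by
    rw [hk]; exact (DKE.continuous_invFT hG.integrable).measurable
  have hkM : ∀ z, ‖DKE.scaledKernel ψσ K (h n) z‖ ≤
      (∫ x, ‖K x‖) * (C * DKE.inverseRate β β₀ ϱ (h n)) * (1 / h n) := by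
    rw [hk]; exact hG.norm_invFT_le
  have hkn := hG.eLpNorm_invFT_le (one_div_pos.2 hn0) hp
  rw [← hk] at hkn
  have hkp : MemLp (DKE.scaledKernel ψσ K (h n)) (ENNReal.ofReal p) :=
    ⟨hkm.aestronglyMeasurable, hkn.trans_lt ENNReal.ofReal_lt_top⟩
  -- The two cases of `varpi` are the two cases of `inverseRate`, shifted by the exponent -(1 - 1/p)
  -- from the bandwidth R = 1/h.
  have hrate : DKE.inverseRate β β₀ ϱ (h n) * (1 / h n) ^ (1 - 1 / p) =
      h n ^ DKE.varpi p β₀ * Real.exp (h n ^ (-β) / ϱ) := by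
    rw [DKE.inverseRate, DKE.varpi, one_div (h n), Real.inv_rpow hn0.le, ← Real.rpow_neg hn0.le]
    split_ifs
    · ring
    · rw [sub_eq_add_neg β₀, Real.rpow_add hn0]; ring
  have hbound : ∫⁻ w : Fin n → ℝ,
      eLpNorm (DKE.centredSum (DKE.scaledKernel ψσ K (h n)) (DKE.obsLaw fX ψσ) w)
        (ENNReal.ofReal p) ∂(Measure.pi fun _ => DKE.obsLaw fX ψσ) ≤
      ENNReal.ofReal (2 * (2 * c) ^ (1 / 2 : ℝ) * ((∫ x, ‖K x‖) * C) *
        ((n : ℝ) ^ (1 / 2 : ℝ) * h n ^ DKE.varpi p β₀ * Real.exp (h n ^ (-β) / ϱ))) := by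
    refine (DKE.lintegral_eLpNorm_centredSum_le hp hc1 hc hkm hkM _ n).trans ?_
    refine (mul_le_mul_right hkn _).trans (le_of_eq ?_)
    rw [← ENNReal.ofReal_mul (by positivity), mul_assoc ((n : ℝ) ^ (1 / 2 : ℝ)), ← hrate,
      Real.mul_rpow (by positivity) n.cast_nonneg]
    congr 1
    ring
  refine ⟨?_, fun B hB => ?_⟩
  · rw [DKE.expectedDeviation_eq hf hψ hn0 hG.integrable hkM p hn]
    exact hbound
  · exact (DKE.expectedSup_le hf hψ hconj hkm hkp n hB.norm_le_one).trans hbound
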